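/- Let $f:\mathbb{C}\to\mathbb{C}$ be an entire function with the following properties: (a) $f(0)=1$; (b) $\sup_{x\in\mathbb{R}}|f(x)|<\infty$; (c) $\int_{-\infty}^{\infty}|f(x)|^2\,dx\le 1$; (d) $f$ is real on $\mathbb{R}$; (e) all zeros of $f$ lie on $\mathbb{R}$ and, if these zeros, repeated according to multiplicity, are labelled by consecutive integers as $$\cdots\le z_{-2}\le z_{-1}<0<z_1\le z_2\le\cdots$$ (where the list may be finite or empty on either side), with the convention $z_0=0$, then $$|z_j-z_k|\ge |j-k|-1$$ for all labels $j,k$ that occur, including the label $0$; (f) for each $\varepsilon>0$ there is a constant $C_\varepsilon$ such that $|f(z)|\le C_\varepsilon e^{\varepsilon|z|^2}$ for all $z\in\mathbb{C}$. Then $$f(z)=\frac{\sin(\pi z)}{\pi z}\qquad\text{for all } z\in\mathbb{C}\setminus\{0\}$$ (and $f(0)=1$, the value of the right side at its removable singularity). -/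

import Mathlib

/-- `IsZeroLabelling f J z` says that the real zeros of `f` (where `f 0 ≠ 0`), repeated according to
multiplicity, are listed in increasing order as
`… ≤ z (-2) ≤ z (-1) < 0 < z 1 ≤ z 2 ≤ …`, with the extra value `z 0 = 0`, which is not a zero.
The set `J` is the set of labels in use: a set of consecutive integers containing `0`, which is
bounded above (below) when there are only finitely many positive (negative) zeros. The values of
`z` outside `J` play no role. -/
structure IsZeroLabelling (f : ℂ → ℂ) (J : Set ℤ) (z : ℤ → ℝ) : Prop where
  zero_mem : (0 : ℤ) ∈ J
  ordConnected : J.OrdConnected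
  map_zero : z 0 = 0
  monotoneOn : MonotoneOn z J
  neg : ∀ j ∈ J, j < 0 → z j < 0
  pos : ∀ j ∈ J, 0 < j → 0 < z j
  /-- Every real `x` is listed as often as its multiplicity as a zero of `f`
  (in particular not at all if `f x ≠ 0`). -/
  order_eq : ∀ x : ℝ, analyticOrderAt f (x : ℂ) = {j : ℤ | j ∈ J ∧ j ≠ 0 ∧ z j = x}.encard

/-! The spacing of the zeros forces exponential type π, and among functions of that type with value
1 at the origin, S(z) = sin(πz)/(πz) alone has the least L² norm on the line.

Type. Divide out the zeros in the disc of radius R. The quotient q has a logarithm L there, with Re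
L ≤ log C + 9εR² by the growth hypothesis. As f is real on ℝ, L'(0) is real, so the linear term of L
does not affect |q(iy)|. The Schwarz lemma bounds the remainder by a term tending to 144εy² as R →
∞. Letting ε → 0, |f(iy)| obeys any bound valid for the finite products of √(1 + y²/z_j²). Since
|z_j| ≥ |j| - 1, Euler's sine product bounds these by e^{π|y|} times a polynomial factor
(`exists_norm_le_imaginary_axis`). Boundedness on ℝ and Phragmén–Lindelöf then give |f(z)| ≤ M
e^{π|Im z|} (`MinimalOrderTwo.norm_le_exp_upper_half_plane`).

Extremality. A contour integral gives ∫ f S = f(0) (`integral_mul_entireSinc`). Used for f and for S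
itself, it yields ∫ |f - S|² = ∫ |f|² - 2 + 1 ≤ 0. -/

open Complex Metric Set Filter Topology MeasureTheory

/-! ### Zero-free functions on a disc -/

/-- A zero-free holomorphic function on a disc has a holomorphic logarithm there. -/
theorem exists_log_on_ball {q : ℂ → ℂ} {R : ℝ} (hR : 0 < R) (hq : DifferentiableOn ℂ q (ball 0 R))
    (hq0 : q 0 = 1) (hne : ∀ z ∈ ball (0 : ℂ) R, q z ≠ 0) :
    ∃ L : ℂ → ℂ, L 0 = 0 ∧ DifferentiableOn ℂ L (ball 0 R) ∧
      (∀ z ∈ ball (0 : ℂ) R, exp (L z) = q z) ∧ deriv L 0 = deriv q 0 := by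
  have hd : DifferentiableOn ℂ (fun z => deriv q z / q z) (ball 0 R) :=
    (hq.deriv isOpen_ball).div hq hne
  obtain ⟨L, hL0, hL⟩ := hd.isExactOn_ball.with_val_at 0 0
  have h0 : (0 : ℂ) ∈ ball (0 : ℂ) R := mem_ball_self hR
  refine ⟨L, hL0, fun z hz => (hL z hz).differentiableAt.differentiableWithinAt, ?_, ?_⟩
  · have hg : ∀ z ∈ ball (0 : ℂ) R, HasDerivAt (fun z => exp (-L z) * q z) 0 z := by
      intro z hz
      have h1 := (hL z hz).neg.cexp.mul
        (hq.differentiableAt (isOpen_ball.mem_nhds hz)).hasDerivAt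
      refine h1.congr_deriv ?_
      have := div_mul_cancel₀ (deriv q z) (hne z hz)
      simp only [Pi.neg_apply]
      linear_combination -exp (-L z) * this
    intro z hz
    have hc := (convex_ball (0 : ℂ) R).is_const_of_fderivWithin_eq_zero (𝕜 := ℂ)
      (f := fun z => exp (-L z) * q z)
      (fun z hz => (hg z hz).differentiableAt.differentiableWithinAt) (fun w hw => by
        rw [fderivWithin_of_isOpen isOpen_ball hw]
        ext
        simp [(hg w hw).deriv]) hz h0
    simp only [hL0, hq0, neg_zero, Complex.exp_zero, mul_one, Complex.exp_neg] at hc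
    field_simp at hc
    exact hc.symm
  · rw [(hL 0 h0).deriv, hq0, div_one]

/-- A zero-free function bounded by `exp M` on the disc of radius `R`, with `q 0 = 1` and real
derivative at `0`, is close to being bounded by `1` on the imaginary axis. -/
theorem norm_le_exp_on_imaginary_axis {q : ℂ → ℂ} {R M : ℝ} (hR : 0 < R) (hM : 0 < M)
    (hq : DifferentiableOn ℂ q (ball 0 R)) (hq0 : q 0 = 1)
    (hne : ∀ z ∈ ball (0 : ℂ) R, q z ≠ 0) (hb : ∀ z ∈ ball (0 : ℂ) R, ‖q z‖ ≤ Real.exp M)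
    (hderiv : (deriv q 0).im = 0) {y : ℝ} (hy : |y| < R / 2) :
    ‖q (y * I)‖ ≤ Real.exp (16 * M * y ^ 2 / R ^ 2) := by
  obtain ⟨L, hL0, hLd, hexp, hLq⟩ := exists_log_on_ball hR hq hq0 hne
  have hsub : ball (0 : ℂ) (R / 2) ⊆ ball 0 R := ball_subset_ball (by linarith)
  have hre : MapsTo L (ball 0 R) {z | z.re ≤ M} := by
    intro z hz
    have := hb z hz
    rw [← hexp z hz, Complex.norm_exp] at this
    exact Real.exp_le_exp.1 this
  have hbd : ∀ z ∈ ball (0 : ℂ) (R / 2), ‖L z‖ ≤ 2 * M := by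
    intro z hz
    refine (borelCaratheodory_zero hM hLd hre hR (hsub hz) hL0).trans ?_
    have hz' : ‖z‖ < R / 2 := by simpa using hz
    rw [div_le_iff₀ (by linarith)]
    nlinarith
  have hL2 : DifferentiableOn ℂ L (ball 0 (R / 2)) := hLd.mono hsub
  have hd0 : ‖deriv L 0‖ ≤ 2 * M / (R / 2) := by
    refine norm_deriv_le_div_of_mapsTo_ball hL2 (fun z hz => ?_) (by linarith)
    simpa [hL0] using hbd z hz
  have hLd0 : HasDerivAt L (deriv L 0) 0 :=
    (hLd.differentiableAt (isOpen_ball.mem_nhds (mem_ball_self hR))).hasDerivAt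
  have hy' : (y * I : ℂ) ∈ ball (0 : ℂ) (R / 2) := by simpa using hy
  -- Schwarz lemma with a double zero: `L z - L'(0) z` is bounded by `4 * M` on radius `R / 2`,
  -- hence by `4 * M * (|y| / (R / 2)) ^ 2` at `y * I`.
  have key := dist_le_mul_div_pow_of_mapsTo_ball_of_isLittleO (n := 1) (c := (0 : ℂ))
    (f := fun z => L z - deriv L 0 * z) (R₁ := R / 2) (R₂ := 4 * M) (z := y * I)
    (hL2.sub (by fun_prop)) (fun z hz => by
      have hz' : ‖z‖ < R / 2 := by simpa using hz
      simp only [hL0, mul_zero, sub_zero, mem_closedBall, dist_zero_right]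
      calc ‖L z - deriv L 0 * z‖ ≤ ‖L z‖ + ‖deriv L 0‖ * ‖z‖ := by
            rw [← norm_mul]; exact norm_sub_le _ _
        _ ≤ 2 * M + 2 * M / (R / 2) * (R / 2) := by gcongr; exact hbd z hz
        _ = 4 * M := by field_simp; ring) (by
      have := hLd0.isLittleO.norm_right
      simpa [hL0, mul_comm] using this) hy'
  have hre2 : (L (y * I)).re ≤ 16 * M * y ^ 2 / R ^ 2 := by
    -- `deriv L 0` is real, so the linear term is purely imaginary at `y * I`.
    have h1 : (L (y * I) - deriv L 0 * (y * I)).re = (L (y * I)).re := by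
      simp [hLq, hderiv]
    rw [← h1]
    refine (re_le_norm _).trans ?_
    simp only [hL0, mul_zero, sub_zero, dist_zero_right] at key
    refine key.trans (le_of_eq ?_)
    simp [div_pow]
    field_simp
    ring
  rw [← hexp _ (hsub hy'), Complex.norm_exp]
  exact Real.exp_le_exp.2 hre2

/-! ### Phragmén–Lindelöf theorems -/

/-- `F` has growth at most order two, minimal type. -/
def MinimalOrderTwo (F : ℂ → ℂ) : Prop :=
  ∀ ε : ℝ, 0 < ε → ∃ C : ℝ, ∀ w : ℂ, ‖F w‖ ≤ C * Real.exp (ε * ‖w‖ ^ 2)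

theorem MinimalOrderTwo.mul_cexp {F : ℂ → ℂ} (hF : MinimalOrderTwo F) (c : ℂ) :
    MinimalOrderTwo (fun z => F z * exp (c * z)) := by
  intro ε hε
  obtain ⟨C, hC⟩ := hF (ε / 2) (by linarith)
  have hC0 : 0 ≤ C := by
    have := (norm_nonneg _).trans (hC 0)
    simpa using this
  refine ⟨C * Real.exp (‖c‖ ^ 2 / (2 * ε)), fun w => ?_⟩
  rw [norm_mul, Complex.norm_exp]
  have h1 : (c * w).re ≤ ‖c‖ ^ 2 / (2 * ε) + ε / 2 * ‖w‖ ^ 2 := by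
    refine (re_le_norm _).trans ?_
    rw [norm_mul, ← sub_nonneg]
    have : ‖c‖ ^ 2 / (2 * ε) + ε / 2 * ‖w‖ ^ 2 - ‖c‖ * ‖w‖ = (‖c‖ - ε * ‖w‖) ^ 2 / (2 * ε) := by
      field_simp
      ring
    rw [this]
    positivity
  calc ‖F w‖ * Real.exp (c * w).re
      ≤ C * Real.exp (ε / 2 * ‖w‖ ^ 2) * Real.exp (‖c‖ ^ 2 / (2 * ε) + ε / 2 * ‖w‖ ^ 2) := by
        gcongr; exact hC w
    _ = C * Real.exp (‖c‖ ^ 2 / (2 * ε)) * Real.exp (ε * ‖w‖ ^ 2) := by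
        rw [mul_assoc, mul_assoc, ← Real.exp_add, ← Real.exp_add]
        ring_nf

theorem MinimalOrderTwo.comp_mul {F : ℂ → ℂ} (hF : MinimalOrderTwo F) {u : ℂ} (hu : ‖u‖ = 1) :
    MinimalOrderTwo (fun z => F (u * z)) := by
  intro ε hε
  obtain ⟨C, hC⟩ := hF ε hε
  exact ⟨C, fun w => by simpa [hu] using hC (u * w)⟩

/-- Phragmén–Lindelöf in the first quadrant for functions of order two and minimal type. -/
theorem MinimalOrderTwo.norm_le_quadrant {F : ℂ → ℂ} (hF : MinimalOrderTwo F)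
    (hd : Differentiable ℂ F) {M : ℝ} (hre : ∀ x : ℝ, 0 ≤ x → ‖F x‖ ≤ M)
    (him : ∀ y : ℝ, 0 ≤ y → ‖F (y * I)‖ ≤ M) {z : ℂ} (hz : 0 ≤ z.re) (hz' : 0 ≤ z.im) :
    ‖F z‖ ≤ M := by
  obtain ⟨ω, hω2, hω⟩ : ∃ ω : ℂ, ω ^ 2 = I ∧ ω = (√2 / 2 : ℝ) * (1 + I) := by
    refine ⟨_, ?_, rfl⟩
    rw [mul_pow, ← ofReal_pow, div_pow, Real.sq_sqrt (by norm_num)]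
    linear_combination (norm := skip) (1 / 2 : ℂ) * I_sq
    push_cast
    ring
  have hωn : ‖ω‖ = 1 := by
    have : ‖ω‖ ^ 2 = 1 := by rw [← norm_pow, hω2, norm_I]
    exact (pow_eq_one_iff_of_nonneg (norm_nonneg _) two_ne_zero).1 this
  have hω0 : ω ≠ 0 := norm_ne_zero_iff.1 (by simp [hωn])
  -- With `ω` the eighth root of unity exp(iπ/4), `Φ` carries the right half-plane to the first
  -- quadrant, with inverse `-I * z ^ 2`. Order two in `z` becomes order one in `s`.
  set Φ : ℂ → ℂ := fun s => ω * s ^ (2⁻¹ : ℂ) with hΦ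
  have hΦn : ∀ s, ‖Φ s‖ ^ 2 = ‖s‖ := by
    intro s
    rw [← norm_pow, hΦ]
    simp only [mul_pow, hω2, norm_mul, norm_I, one_mul]
    congr 1
    exact_mod_cast Complex.cpow_nat_inv_pow s two_ne_zero
  have hΦz : ∀ z : ℂ, 0 ≤ z.re → 0 ≤ z.im → Φ (-I * z ^ 2) = z := by
    intro z h1 h2
    rcases eq_or_ne z 0 with rfl | hz0
    · simp [hΦ]
    have h3 : -I * z ^ 2 = (z / ω) ^ 2 := by
      rw [div_pow, hω2, div_I]; ring
    have h4 : 0 < (z / ω).re := by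
      have h5 : z / ω = (√2 / 2 : ℝ) * (1 - I) * z := by
        rw [div_eq_iff hω0, hω]
        have : ((√2 / 2 : ℝ) : ℂ) ^ 2 = 1 / 2 := by
          rw [← ofReal_pow, div_pow, Real.sq_sqrt (by norm_num)]; push_cast; norm_num
        linear_combination (norm := skip) (-2 * z) * this + ((√2 / 2 : ℝ) : ℂ) ^ 2 * z * I_sq
        ring
      rw [h5, mul_assoc, re_ofReal_mul]
      have : 0 < z.re + z.im := by
        rcases h1.lt_or_eq with h | h
        · linarith
        · rcases h2.lt_or_eq with h' | h'
          · linarith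
          · exact absurd (Complex.ext h.symm h'.symm) hz0
      have h6 : ((1 - I) * z).re = z.re + z.im := by simp
      rw [h6]
      positivity
    rw [hΦ]
    simp only [h3]
    rw [Complex.sq_cpow_two_inv h4, mul_div_cancel₀ _ hω0]
  have key : ∀ δ : ℝ, 0 < δ → ‖F z‖ * ‖exp (-δ * (-I * z ^ 2))‖ ≤ M := by
    intro δ hδ
    obtain ⟨C, hC⟩ := hF δ hδ
    have hres : 0 ≤ (-I * z ^ 2).re := by
      simp [pow_two]; positivity
    have hΦc : ∀ s : ℂ, 0 ≤ s.re → ContinuousAt Φ s := by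
      intro s hs
      refine continuousAt_const.mul ?_
      rcases eq_or_ne s 0 with rfl | h0
      · have := Complex.continuousAt_cpow_zero_of_re_pos (z := (2⁻¹ : ℂ)) (by norm_num)
        exact this.comp (f := fun x : ℂ => (x, (2⁻¹ : ℂ))) (by fun_prop)
      · refine continuousAt_id.cpow continuousAt_const ?_
        rcases hs.lt_or_eq with h | h
        · exact Or.inl h
        · refine Or.inr fun hi => h0 (Complex.ext h.symm hi)
    -- The same `δ` governs the growth of `F` and the damping factor, so the exponentials cancel on
    -- the positive real axis. On the imaginary axis the factor has modulus 1.
    have hgrow : ∀ s : ℂ, ‖F (Φ s) * exp (-δ * s)‖ ≤ C * Real.exp (δ * ‖s‖ - δ * s.re) := by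
      intro s
      rw [norm_mul, Complex.norm_exp]
      have h1 := hC (Φ s)
      rw [hΦn] at h1
      have h2 : (-δ * s : ℂ).re = - (δ * s.re) := by simp
      rw [h2, sub_eq_add_neg, Real.exp_add, ← mul_assoc]
      gcongr
    have := PhragmenLindelof.right_half_plane_of_bounded_on_real (C := M)
      (f := fun s => F (Φ s) * exp (-δ * s)) (z := -I * z ^ 2) ?_ ?_ ?_ ?_ hres
    · simpa only [norm_mul, hΦz z hz hz'] using this
    · constructor
      · intro s hs
        have hΦd : DifferentiableAt ℂ Φ s :=
          (differentiableAt_id.cpow_const (Or.inl hs)).const_mul _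
        exact (((hd _).comp s hΦd).mul (by fun_prop)).differentiableWithinAt
      · rw [closure_setOfPred_lt_re]
        intro s hs
        exact ((hd.continuous.continuousAt.comp (hΦc s hs)).mul
          (by fun_prop)).continuousWithinAt
    · refine ⟨1, by norm_num, δ, Asymptotics.IsBigO.of_bound C ?_⟩
      refine eventually_inf_principal.2 (Eventually.of_forall fun s hs => ?_)
      refine (hgrow s).trans ?_
      have hC0 : 0 ≤ C := by
        have := (norm_nonneg _).trans (hC 0)
        simpa using this
      rw [Real.norm_eq_abs, Real.abs_exp, Real.rpow_one]
      gcongr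
      have : 0 < s.re := hs
      nlinarith
    · refine ⟨C, eventually_map.2 ?_⟩
      filter_upwards [eventually_ge_atTop 0] with x hx
      refine (hgrow x).trans (le_of_eq ?_)
      simp [abs_of_nonneg hx]
    · intro t
      have hn : ‖exp (-δ * (t * I))‖ = 1 := by
        rw [Complex.norm_exp]; simp
      rw [norm_mul, hn, mul_one]
      rcases le_total 0 t with ht | ht
      · have h1 : (t * I : ℂ) = -I * (√t * I) ^ 2 := by
          rw [mul_pow, ← ofReal_pow, Real.sq_sqrt ht, I_sq]; ring
        rw [h1, hΦz _ (by simp) (by simp)]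
        exact him _ (Real.sqrt_nonneg _)
      · have h1 : (t * I : ℂ) = -I * ((√(-t) : ℝ) : ℂ) ^ 2 := by
          rw [← ofReal_pow, Real.sq_sqrt (by linarith)]; push_cast; ring
        rw [h1, hΦz _ (by simp) (by simp)]
        exact hre _ (Real.sqrt_nonneg _)
  have hlim : Tendsto (fun δ : ℝ => ‖F z‖ * ‖exp (-δ * (-I * z ^ 2))‖) (𝓝[>] 0) (𝓝 ‖F z‖) := by
    have hc : Continuous (fun δ : ℝ => ‖F z‖ * ‖exp (-δ * (-I * z ^ 2))‖) := by fun_prop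
    exact (hc.tendsto' 0 _ (by simp)).mono_left nhdsWithin_le_nhds
  exact le_of_tendsto hlim (eventually_nhdsWithin_of_forall fun δ hδ => key δ hδ)

/-- Phragmén–Lindelöf for bounded functions in the upper half-plane. -/
theorem norm_le_upper_half_plane_of_bounded {G : ℂ → ℂ} {B C : ℝ}
    (hd : ∀ z : ℂ, 0 ≤ z.im → DifferentiableAt ℂ G z)
    (hB : ∀ z : ℂ, 0 ≤ z.im → ‖G z‖ ≤ B) (hC : ∀ x : ℝ, ‖G x‖ ≤ C) {z : ℂ} (hz : 0 ≤ z.im) :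
    ‖G z‖ ≤ C := by
  have him : ∀ s : ℂ, (I * s).im = s.re := by simp
  have hd' : ∀ s : ℂ, 0 ≤ s.re → DifferentiableAt ℂ (fun s => G (I * s)) s := fun s hs =>
    (hd (I * s) (by rwa [him])).comp s (by fun_prop)
  have := PhragmenLindelof.right_half_plane_of_bounded_on_real (C := C)
    (f := fun s => G (I * s)) (z := -I * z) ?_ ?_ ?_ ?_ (by simpa using hz)
  · simpa [← mul_assoc] using this
  · constructor
    · exact fun s hs => (hd' s (le_of_lt hs)).differentiableWithinAt
    · rw [closure_setOfPred_lt_re]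
      exact fun s hs => (hd' s hs).continuousAt.continuousWithinAt
  · refine ⟨1, by norm_num, 0, Asymptotics.IsBigO.of_bound B ?_⟩
    refine eventually_inf_principal.2 (Eventually.of_forall fun s hs => ?_)
    simpa using hB (I * s) (by rw [him]; exact le_of_lt hs)
  · refine ⟨B, eventually_map.2 ?_⟩
    filter_upwards [eventually_ge_atTop 0] with x hx
    exact hB _ (by simpa using hx)
  · intro x
    have : I * (x * I) = ((-x : ℝ) : ℂ) := by
      push_cast; linear_combination (x : ℂ) * I_sq
    rw [this]
    exact hC _

/-- Phragmén–Lindelöf in the upper half-plane for functions of order two and minimal type which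
grow subexponentially along the imaginary axis. -/
theorem MinimalOrderTwo.norm_le_upper_half_plane {F : ℂ → ℂ} (hF : MinimalOrderTwo F)
    (hd : Differentiable ℂ F) {M : ℝ} (hre : ∀ x : ℝ, ‖F x‖ ≤ M)
    (him : ∀ δ : ℝ, 0 < δ → ∃ C : ℝ, ∀ y : ℝ, 0 ≤ y → ‖F (y * I)‖ ≤ C * Real.exp (δ * y))
    {z : ℂ} (hz : 0 ≤ z.im) : ‖F z‖ ≤ M := by
  have key : ∀ δ : ℝ, 0 < δ → ‖F z‖ * ‖exp (δ * I * z)‖ ≤ M := by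
    intro δ hδ
    obtain ⟨C, hC⟩ := him δ hδ
    set G : ℂ → ℂ := fun w => F w * exp (δ * I * w) with hG
    have hGd : Differentiable ℂ G := by fun_prop
    have hGm : MinimalOrderTwo G := hF.mul_cexp _
    have hGre : ∀ x : ℝ, ‖G x‖ ≤ M := by
      intro x
      have : ‖exp (δ * I * x)‖ = 1 := by rw [Complex.norm_exp]; simp
      simpa [hG, this] using hre x
    have hGim : ∀ y : ℝ, 0 ≤ y → ‖G (y * I)‖ ≤ C := by
      intro y hy
      have : ‖exp (δ * I * (y * I))‖ = Real.exp (-(δ * y)) := by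
        rw [Complex.norm_exp]; simp
      rw [hG, norm_mul, this]
      calc ‖F (y * I)‖ * Real.exp (-(δ * y))
          ≤ C * Real.exp (δ * y) * Real.exp (-(δ * y)) := by gcongr; exact hC y hy
        _ = C := by rw [mul_assoc, ← Real.exp_add]; simp
    -- The two quadrants give only the crude bound `max M C`. Once `G` is known to be bounded, the
    -- half-plane version restores the constant `M` of the real axis.
    have hB : ∀ w : ℂ, 0 ≤ w.im → ‖G w‖ ≤ max M C := by
      intro w hw
      rcases le_total 0 w.re with h | h
      · exact hGm.norm_le_quadrant hGd (fun x _ => (hGre x).trans (le_max_left _ _))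
          (fun y hy => (hGim y hy).trans (le_max_right _ _)) h hw
      · have := (hGm.comp_mul norm_I).norm_le_quadrant (M := max M C) (z := -I * w)
          (hGd.comp (by fun_prop))
          (fun x hx => by
            rw [mul_comm]; exact (hGim x hx).trans (le_max_right _ _))
          (fun y hy => by
            have : I * (y * I) = ((-y : ℝ) : ℂ) := by
              push_cast; linear_combination (y : ℂ) * I_sq
            rw [this]
            exact (hGre _).trans (le_max_left _ _)) (by simpa using hw) (by simpa using h)
        simpa [← mul_assoc] using this
    have := norm_le_upper_half_plane_of_bounded (fun w _ => hGd w) hB hGre hz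
    rwa [hG, norm_mul] at this
  have hlim : Tendsto (fun δ : ℝ => ‖F z‖ * ‖exp (δ * I * z)‖) (𝓝[>] 0) (𝓝 ‖F z‖) := by
    have hc : Continuous (fun δ : ℝ => ‖F z‖ * ‖exp (δ * I * z)‖) := by fun_prop
    exact (hc.tendsto' 0 _ (by simp)).mono_left nhdsWithin_le_nhds
  exact le_of_tendsto hlim (eventually_nhdsWithin_of_forall fun δ hδ => key δ hδ)

/-! ### Decay at infinity and contour integration -/

/-- A function bounded on the upper half-plane which tends to zero along the real axis tends to
zero uniformly in the upper half-plane. -/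
theorem norm_le_of_tendsto_zero_on_real {A : ℂ → ℂ} (hA : Differentiable ℂ A) {M : ℝ}
    (hM : ∀ z : ℂ, 0 ≤ z.im → ‖A z‖ ≤ M)
    (h0 : Tendsto (fun x : ℝ => A x) (cocompact ℝ) (𝓝 0)) {ε : ℝ} (hε : 0 < ε) :
    ∃ K : ℝ, 0 < K ∧ ∀ z : ℂ, 0 ≤ z.im → K ≤ ‖z‖ → ‖A z‖ ≤ ε := by
  obtain ⟨X, hX⟩ : ∃ X : ℝ, ∀ x : ℝ, X < |x| → ‖A x‖ ≤ ε / 2 := by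
    have h1 : ∀ᶠ x : ℝ in cocompact ℝ, ‖A x‖ ≤ ε / 2 := by
      have := h0.norm
      rw [norm_zero] at this
      exact this.eventually (ge_mem_nhds (by linarith))
    rw [← cobounded_eq_cocompact, ← comap_norm_atTop, eventually_comap] at h1
    obtain ⟨X, hX⟩ := (eventually_atTop.1 h1)
    exact ⟨X, fun x hx => hX |x| hx.le x rfl⟩
  have hM0 : 0 ≤ M := (norm_nonneg _).trans (hM 0 (by simp))
  obtain ⟨K, hK0, hK⟩ : ∃ K : ℝ, 0 < K ∧ M * |X| ≤ ε / 2 * K := by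
    refine ⟨2 * (M * |X|) / ε + 1, by positivity, ?_⟩
    have : ε / 2 * (2 * (M * |X|) / ε + 1) = M * |X| + ε / 2 := by field_simp
    linarith
  have him : ∀ z : ℂ, 0 ≤ z.im → K ≤ ‖z + K * I‖ ∧ ‖z‖ ≤ ‖z + K * I‖ := by
    intro z hz
    constructor
    · refine le_trans ?_ (im_le_norm _)
      simpa using hz
    · rw [← sq_le_sq₀ (norm_nonneg _) (norm_nonneg _), Complex.sq_norm, Complex.sq_norm,
        normSq_apply, normSq_apply]
      simp
      nlinarith
  -- The factor `z / (z + K * I)` has modulus at most 1 on the half-plane and is small for `|x| ≤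
  -- |X|`, where `A` itself need not be. Removing it for `‖z‖ ≥ K` costs a factor 2.
  have hG : ∀ z : ℂ, 0 ≤ z.im → ‖A z * (z / (z + K * I))‖ ≤ ε / 2 := by
    intro z hz
    refine norm_le_upper_half_plane_of_bounded (G := fun z => A z * (z / (z + K * I))) (B := M)
      ?_ ?_ ?_ hz
    · intro w hw
      have : w + K * I ≠ 0 := norm_pos_iff.1 (hK0.trans_le (him w hw).1)
      exact (hA w).mul (differentiableAt_id.div (by fun_prop) this)
    · intro w hw
      have h1 := him w hw
      rw [norm_mul, norm_div]
      exact (mul_le_of_le_one_right (norm_nonneg _)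
        (div_le_one_of_le₀ h1.2 (norm_nonneg _))).trans (hM w hw)
    · intro x
      have h1 := him x (by simp)
      rw [norm_mul, norm_div]
      rcases lt_or_ge X |x| with h | h
      · exact (mul_le_of_le_one_right (norm_nonneg _)
          (div_le_one_of_le₀ h1.2 (norm_nonneg _))).trans (hX x h)
      · have h2 : ‖(x : ℂ)‖ ≤ |X| := by
          rw [norm_real]; exact h.trans (le_abs_self _)
        calc ‖A x‖ * (‖(x : ℂ)‖ / ‖(x : ℂ) + K * I‖) ≤ M * (|X| / K) := by
              gcongr
              · exact hM x (by simp)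
              · exact h1.1
          _ ≤ ε / 2 := by rw [← mul_div_assoc, div_le_iff₀ hK0]; exact hK
  refine ⟨K, hK0, fun z hz hzK => ?_⟩
  have hz0 : 0 < ‖z‖ := hK0.trans_le hzK
  have h1 := hG z hz
  have h2 : 0 < ‖z + K * I‖ := hK0.trans_le (him z hz).1
  have h3 : ‖z + K * I‖ ≤ 2 * ‖z‖ := by
    refine (norm_add_le _ _).trans ?_
    simp [abs_of_pos hK0]
    linarith
  rw [norm_mul, norm_div, ← mul_div_assoc, div_le_iff₀ h2] at h1
  have : ‖A z‖ * ‖z‖ ≤ ε * ‖z‖ := by nlinarith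
  exact le_of_mul_le_mul_right this hz0

/-- The entire-up-to-`-I` function `A z - A 0 * I / (z + I)`, divided by `z`. -/
noncomputable def contourKernel (A : ℂ → ℂ) : ℂ → ℂ :=
  dslope (fun z => A z - A 0 * (I / (z + I))) 0

theorem contourKernel_of_ne {A : ℂ → ℂ} {z : ℂ} (hz : z ≠ 0) :
    contourKernel A z = (A z - A 0 * (I / (z + I))) / z := by
  rw [contourKernel, dslope_of_ne _ hz, slope_def_field]
  simp

theorem differentiableOn_contourKernel {A : ℂ → ℂ} (hA : Differentiable ℂ A) :
    DifferentiableOn ℂ (contourKernel A) {z : ℂ | -1 < z.im} := by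
  have hopen : IsOpen {z : ℂ | -1 < z.im} := isOpen_lt continuous_const continuous_im
  rw [contourKernel, differentiableOn_dslope (hopen.mem_nhds (by simp))]
  intro z hz
  have hz' : z + I ≠ 0 := by
    intro h
    have := congrArg im h
    simp at this
    have h2 : -1 < z.im := hz
    linarith
  exact ((hA z).sub ((differentiableAt_const _).mul
    ((differentiableAt_const _).div (by fun_prop) hz'))).differentiableWithinAt

/-- The subtracted `A 0 * (I / (z + I))` cancels the pole at 0, decays at infinity, and has its own
pole outside the upper half-plane. Cauchy's theorem moves the integral to the other three sides of
the rectangle with base `[-R, R]` and height `R`, where the kernel is o(1/R). -/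
theorem tendsto_integral_contourKernel {A : ℂ → ℂ} (hA : Differentiable ℂ A) {M : ℝ}
    (hM : ∀ z : ℂ, 0 ≤ z.im → ‖A z‖ ≤ M)
    (h0 : Tendsto (fun x : ℝ => A x) (cocompact ℝ) (𝓝 0)) :
    Tendsto (fun R : ℝ => ∫ x in (-R)..R, contourKernel A x) atTop (𝓝 0) := by
  rw [Metric.tendsto_nhds]
  intro ε hε
  obtain ⟨K, hK0, hK⟩ := norm_le_of_tendsto_zero_on_real hA hM h0 (ε := ε / 16) (by linarith)
  filter_upwards [eventually_ge_atTop (max K (16 * ‖A 0‖ / ε)), eventually_gt_atTop 0] with R hR hR0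
  have hRK : K ≤ R := (le_max_left _ _).trans hR
  have hRA : ‖A 0‖ ≤ ε / 16 * R := by
    have := (le_max_right _ _).trans hR
    rw [div_le_iff₀ hε] at this
    linarith
  have hdiff := differentiableOn_contourKernel hA
  have hbd : ∀ z : ℂ, 0 ≤ z.im → R ≤ ‖z‖ → ‖contourKernel A z‖ ≤ ε / 8 / R := by
    intro z hz hzR
    have hz0 : z ≠ 0 := norm_pos_iff.1 (hR0.trans_le hzR)
    rw [contourKernel_of_ne hz0, norm_div]
    have h1 : ‖z‖ ≤ ‖z + I‖ := by
      rw [← sq_le_sq₀ (norm_nonneg _) (norm_nonneg _), Complex.sq_norm, Complex.sq_norm,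
        normSq_apply, normSq_apply]
      simp
      nlinarith
    have h2 : ‖A 0 * (I / (z + I))‖ ≤ ε / 16 := by
      rw [norm_mul, norm_div, norm_I, mul_one_div]
      rw [div_le_iff₀ (by linarith)]
      nlinarith
    have h3 : ‖A z - A 0 * (I / (z + I))‖ ≤ ε / 8 := by
      refine (norm_sub_le _ _).trans ?_
      linarith [hK z hz (hRK.trans hzR)]
    gcongr
  have hrect := integral_boundary_rect_eq_zero_of_differentiableOn (contourKernel A)
    (-R : ℝ) (R + R * I) (hdiff.mono (by
      rintro z ⟨-, hz⟩
      simp only [ofReal_im, add_im, mul_im, ofReal_re, I_im, mul_one, I_re, mul_zero, add_zero,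
        zero_add, mem_preimage, uIcc_of_le hR0.le] at hz
      have := hz.1
      simp only [mem_ofPred_eq]
      linarith))
  simp only [ofReal_im, add_im, mul_im, ofReal_re, I_im, mul_one, I_re, mul_zero, add_zero,
    zero_add, add_re, mul_re, ofReal_zero, zero_mul, sub_self] at hrect
  have e1 : ‖∫ x in (-R)..R, contourKernel A (x + R * I)‖ ≤ ε / 8 / R * |R - -R| := by
    refine intervalIntegral.norm_integral_le_of_norm_le_const fun x hx => ?_
    refine hbd _ (by simpa using hR0.le) ?_
    refine le_trans ?_ ((le_abs_self _).trans (abs_im_le_norm _))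
    simp
  have e2 : ‖∫ y in (0 : ℝ)..R, contourKernel A (R + y * I)‖ ≤ ε / 8 / R * |R - 0| := by
    refine intervalIntegral.norm_integral_le_of_norm_le_const fun x hx => ?_
    rw [uIoc_of_le hR0.le] at hx
    refine hbd _ (by simpa using hx.1.le) ?_
    refine le_trans ?_ (abs_re_le_norm _)
    simp [abs_of_pos hR0]
  have e3 : ‖∫ y in (0 : ℝ)..R, contourKernel A ((-R : ℝ) + y * I)‖ ≤ ε / 8 / R * |R - 0| := by
    refine intervalIntegral.norm_integral_le_of_norm_le_const fun x hx => ?_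
    rw [uIoc_of_le hR0.le] at hx
    refine hbd _ (by simpa using hx.1.le) ?_
    refine le_trans ?_ (abs_re_le_norm _)
    simp [abs_of_pos hR0]
  have c1 : ε / 8 / R * |R - -R| = ε / 4 := by
    rw [sub_neg_eq_add, abs_of_pos (by linarith)]; field_simp; ring
  have c2 : ε / 8 / R * |R - 0| = ε / 8 := by
    rw [sub_zero, abs_of_pos hR0]; field_simp
  rw [c1] at e1
  rw [c2] at e2 e3
  rw [dist_zero_right]
  have : ∫ x in (-R)..R, contourKernel A x = (∫ x in (-R)..R, contourKernel A (x + R * I))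
      - I * (∫ y in (0 : ℝ)..R, contourKernel A (R + y * I))
      + I * ∫ y in (0 : ℝ)..R, contourKernel A ((-R : ℝ) + y * I) := by
    simp only [smul_eq_mul] at hrect
    linear_combination hrect
  rw [this]
  refine (norm_add_le _ _).trans_lt ?_
  refine (add_le_add_left (norm_sub_le _ _) _).trans_lt ?_
  rw [norm_mul, norm_mul, norm_I, one_mul, one_mul]
  linarith

/-- A Lipschitz square-integrable function on the line tends to zero at infinity. -/
theorem tendsto_zero_of_lipschitz_of_integrable_sq {g : ℝ → ℂ} {L : ℝ}
    (hL : ∀ x y, ‖g x - g y‖ ≤ L * |x - y|) (hg : Integrable (fun x => ‖g x‖ ^ 2)) :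
    Tendsto g (cocompact ℝ) (𝓝 0) := by
  have hL0 : 0 ≤ L := by
    have := (norm_nonneg _).trans (hL 1 0)
    simpa using this
  have hlim : ∀ η : ℝ, Tendsto (fun x : ℝ => ∫ t in (x - η)..(x + η), ‖g t‖ ^ 2)
      (cocompact ℝ) (𝓝 0) := by
    intro η
    have hi : ∀ a b, IntervalIntegrable (fun x => ‖g x‖ ^ 2) volume a b :=
      fun a b => hg.intervalIntegrable
    have heq : (fun x : ℝ => ∫ t in (x - η)..(x + η), ‖g t‖ ^ 2) =
        fun x => (∫ t in (0 : ℝ)..(x + η), ‖g t‖ ^ 2) - ∫ t in (0 : ℝ)..(x - η), ‖g t‖ ^ 2 := by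
      ext x
      rw [intervalIntegral.integral_interval_sub_left (hi _ _) (hi _ _)]
    rw [cocompact_eq_atBot_atTop, tendsto_sup, heq]
    constructor
    · have h1 : Tendsto (fun b : ℝ => ∫ t in (0 : ℝ)..b, ‖g t‖ ^ 2) atBot
          (𝓝 (-∫ t in Iic (0 : ℝ), ‖g t‖ ^ 2)) := by
        have := (intervalIntegral_tendsto_integral_Iic 0 hg.integrableOn tendsto_id).neg
        refine this.congr fun b => ?_
        rw [intervalIntegral.integral_symm]
        simp
      have := (h1.comp (tendsto_atBot_add_const_right _ η tendsto_id)).sub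
        (h1.comp (tendsto_atBot_add_const_right _ (-η) tendsto_id))
      rw [sub_self] at this
      exact this
    · have h1 : Tendsto (fun b : ℝ => ∫ t in (0 : ℝ)..b, ‖g t‖ ^ 2) atTop
          (𝓝 (∫ t in Ioi (0 : ℝ), ‖g t‖ ^ 2)) :=
        intervalIntegral_tendsto_integral_Ioi 0 hg.integrableOn tendsto_id
      have := (h1.comp (tendsto_atTop_add_const_right _ η tendsto_id)).sub
        (h1.comp (tendsto_atTop_add_const_right _ (-η) tendsto_id))
      rw [sub_self] at this
      exact this
  rw [tendsto_zero_iff_norm_tendsto_zero, Metric.tendsto_nhds]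
  intro ε hε
  obtain ⟨η, hη, hLη⟩ : ∃ η : ℝ, 0 < η ∧ L * η ≤ ε / 2 := by
    refine ⟨ε / 2 / (L + 1), by positivity, ?_⟩
    rw [← mul_div_assoc, div_le_iff₀ (by positivity)]
    nlinarith
  have hev := (hlim η).eventually (gt_mem_nhds (show (0 : ℝ) < 2 * η * (ε / 2) ^ 2 by positivity))
  filter_upwards [hev] with x hx
  rw [dist_zero_right, norm_norm]
  by_contra! hcon
  -- A value of size `ε` at `x` forces size `ε / 2` on the whole window, so the window integral
  -- would be at least `2 * η * (ε / 2) ^ 2`.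
  have hlow : ∀ t ∈ Icc (x - η) (x + η), (ε / 2) ^ 2 ≤ ‖g t‖ ^ 2 := by
    intro t ht
    have h1 := hL x t
    have h2 : |x - t| ≤ η := abs_le.2 ⟨by linarith [ht.2], by linarith [ht.1]⟩
    have h3 := norm_sub_norm_le (g x) (g t)
    have h4 : L * |x - t| ≤ L * η := by gcongr
    have h5 : ε / 2 ≤ ‖g t‖ := by linarith
    gcongr
  have := intervalIntegral.integral_mono_on (μ := volume) (by linarith) intervalIntegrable_const
    hg.intervalIntegrable hlow
  rw [intervalIntegral.integral_const, smul_eq_mul] at this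
  linarith

/-! ### The sinc function and its reproducing property -/

/-- The entire function `sin (π z) / (π z)`. -/
noncomputable def entireSinc : ℂ → ℂ := dslope (fun z => sin (Real.pi * z) / Real.pi) 0

theorem entireSinc_of_ne {z : ℂ} (hz : z ≠ 0) :
    entireSinc z = sin (Real.pi * z) / (Real.pi * z) := by
  rw [entireSinc, dslope_of_ne _ hz, slope_def_field]
  simp [div_div]

theorem entireSinc_zero : entireSinc 0 = 1 := by
  rw [entireSinc, dslope_same]
  have h : HasDerivAt (fun z : ℂ => sin (Real.pi * z) / Real.pi) 1 0 := by
    have h1 := (((hasDerivAt_id (0 : ℂ)).const_mul (Real.pi : ℂ)).csin).div_const (Real.pi : ℂ)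
    refine h1.congr_deriv ?_
    simp [Real.pi_ne_zero]
  exact h.deriv

theorem differentiable_entireSinc : Differentiable ℂ entireSinc := by
  rw [← differentiableOn_univ, entireSinc, differentiableOn_dslope univ_mem]
  fun_prop

theorem norm_sin_le (z : ℂ) : ‖sin z‖ ≤ Real.exp |z.im| := by
  have h1 : ‖exp (-z * I)‖ ≤ Real.exp |z.im| := by
    rw [Complex.norm_exp]
    simpa using le_abs_self z.im
  have h2 : ‖exp (z * I)‖ ≤ Real.exp |z.im| := by
    rw [Complex.norm_exp]
    simpa using neg_le_abs z.im
  rw [Complex.sin, norm_div, norm_mul, norm_I, mul_one]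
  have := norm_sub_le (exp (-z * I)) (exp (z * I))
  simp only [Complex.norm_ofNat]
  linarith

theorem exists_norm_entireSinc_le :
    ∃ M : ℝ, ∀ z : ℂ, ‖entireSinc z‖ ≤ M * Real.exp (Real.pi * |z.im|) := by
  obtain ⟨M, hM⟩ := (isCompact_closedBall (0 : ℂ) 1).exists_bound_of_continuousOn
    differentiable_entireSinc.continuous.continuousOn
  refine ⟨max M 1, fun z => ?_⟩
  rcases le_or_gt ‖z‖ 1 with h | h
  · calc ‖entireSinc z‖ ≤ M := hM z (by simpa using h)
      _ ≤ max M 1 * 1 := by simp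
      _ ≤ _ := by gcongr; exact Real.one_le_exp (by positivity)
  · have hz : z ≠ 0 := norm_pos_iff.1 (by linarith)
    have hpi := Real.pi_gt_three
    rw [entireSinc_of_ne hz, norm_div]
    have h1 := norm_sin_le (Real.pi * z)
    rw [im_ofReal_mul, abs_mul, abs_of_pos Real.pi_pos] at h1
    have h2 : 1 ≤ ‖(Real.pi : ℂ) * z‖ := by
      rw [norm_mul, norm_real, Real.norm_of_nonneg Real.pi_pos.le]; nlinarith
    calc _ ≤ Real.exp (Real.pi * |z.im|) / 1 := by gcongr
      _ ≤ _ := by rw [div_one]; exact le_mul_of_one_le_left (Real.exp_nonneg _) (le_max_right _ _)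

theorem memLp_entireSinc : MemLp (fun x : ℝ => entireSinc x) 2 := by
  have hc : Continuous (fun x : ℝ => entireSinc x) :=
    differentiable_entireSinc.continuous.comp continuous_ofReal
  rw [memLp_two_iff_integrable_sq_norm hc.aestronglyMeasurable]
  obtain ⟨M, hM⟩ := exists_norm_entireSinc_le
  refine (integrable_inv_one_add_sq.const_mul (M ^ 2 + 1)).mono'
    (hc.norm.pow 2).aestronglyMeasurable (Eventually.of_forall fun x => ?_)
  rw [Real.norm_of_nonneg (by positivity), ← div_eq_mul_inv, le_div_iff₀ (by positivity)]
  have h1 : ‖entireSinc x‖ ≤ M := by simpa using hM x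
  have h2 : ‖entireSinc x‖ * |x| ≤ 1 := by
    rcases eq_or_ne x 0 with rfl | hx
    · simp
    rw [entireSinc_of_ne (by exact_mod_cast hx), norm_div, norm_mul, norm_real, norm_real,
      Real.norm_of_nonneg Real.pi_pos.le, Real.norm_eq_abs, div_mul_eq_mul_div,
      div_le_iff₀ (by positivity)]
    have h3 := norm_sin_le (Real.pi * x)
    simp at h3
    have := Real.pi_gt_three
    rw [one_mul]
    gcongr
    linarith
  have h4 : (‖entireSinc x‖ * |x|) ^ 2 ≤ 1 := pow_le_one₀ (by positivity) h2
  have h5 : ‖entireSinc x‖ ^ 2 ≤ M ^ 2 := by gcongr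
  rw [mul_pow, sq_abs] at h4
  linarith

/-- The reproducing formula of the Paley–Wiener space at the origin. -/
theorem integral_mul_entireSinc {f : ℂ → ℂ} (hf : Differentiable ℂ f) {M : ℝ}
    (hM : ∀ z, ‖f z‖ ≤ M * Real.exp (Real.pi * |z.im|))
    (h2 : MemLp (fun x : ℝ => f x) 2) :
    ∫ x : ℝ, f x * entireSinc x = f 0 := by
  have hM0 : 0 ≤ M := by simpa using (norm_nonneg _).trans (hM 0)
  -- Cauchy's estimate on unit circles centred on the line, where `|w.im| ≤ 1`.
  have hlip : ∀ x y : ℝ, ‖f x - f y‖ ≤ (M * Real.exp Real.pi) * |x - y| := by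
    intro x y
    have := (convex_univ (E := ℝ) (𝕜 := ℝ)).norm_image_sub_le_of_norm_hasDerivWithin_le
      (f := fun t : ℝ => f t) (f' := fun t : ℝ => deriv f t) (C := M * Real.exp Real.pi)
      (fun t _ => ((hf t).hasDerivAt.comp_ofReal).hasDerivWithinAt) (fun t _ => by
        have := norm_deriv_le_of_forall_mem_sphere_norm_le (c := (t : ℂ)) (C := M * Real.exp Real.pi)
          one_pos hf.diffContOnCl (fun w hw => by
            refine (hM w).trans ?_
            have h3 : |w.im| ≤ 1 := by
              have := abs_im_le_norm (w - t)
              rw [mem_sphere_iff_norm] at hw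
              simpa [hw] using this
            have : Real.pi * |w.im| ≤ Real.pi := by nlinarith [Real.pi_pos]
            gcongr)
        simpa using this) (mem_univ y) (mem_univ x)
    simpa using this
  have hc : Continuous (fun x : ℝ => f x) := hf.continuous.comp continuous_ofReal
  have hsq : Integrable (fun x : ℝ => ‖f x‖ ^ 2) :=
    (memLp_two_iff_integrable_sq_norm hc.aestronglyMeasurable).1 h2
  have hdecay : Tendsto (fun x : ℝ => f x) (cocompact ℝ) (𝓝 0) :=
    tendsto_zero_of_lipschitz_of_integrable_sq hlip hsq
  have hA : ∀ g : ℂ → ℂ, Differentiable ℂ g → (∀ z, ‖g z‖ ≤ M * Real.exp (Real.pi * |z.im|)) →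
      Tendsto (fun x : ℝ => g x) (cocompact ℝ) (𝓝 0) →
      Tendsto (fun R : ℝ => ∫ x in (-R)..R,
        contourKernel (fun z => g z * exp (Real.pi * I * z)) x) atTop (𝓝 0) ∧
      ∀ R, IntervalIntegrable (fun x : ℝ =>
        contourKernel (fun z => g z * exp (Real.pi * I * z)) x) volume (-R) R := by
    intro g hg hgM hg0
    have hd : Differentiable ℂ (fun z => g z * exp (Real.pi * I * z)) := by fun_prop
    have hn : ∀ z : ℂ, ‖exp (Real.pi * I * z)‖ = Real.exp (-(Real.pi * z.im)) := by
      intro z; rw [Complex.norm_exp]; simp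
    refine ⟨tendsto_integral_contourKernel hd (M := M) ?_ ?_, ?_⟩
    · intro z hz
      have := hgM z
      rw [abs_of_nonneg hz] at this
      rw [norm_mul, hn]
      calc _ ≤ M * Real.exp (Real.pi * z.im) * Real.exp (-(Real.pi * z.im)) := by gcongr
        _ = M := by rw [mul_assoc, ← Real.exp_add]; simp
    · rw [tendsto_zero_iff_norm_tendsto_zero] at hg0 ⊢
      refine hg0.congr fun x => ?_
      simp [hn]
    · intro R
      have hcont : Continuous (fun x : ℝ =>
          contourKernel (fun z => g z * exp (Real.pi * I * z)) x) := by
        exact (differentiableOn_contourKernel hd).continuousOn.comp_continuous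
          continuous_ofReal (by simp)
      exact hcont.intervalIntegrable _ _
  obtain ⟨t1, i1⟩ := hA f hf hM hdecay
  obtain ⟨t2, i2⟩ := hA (fun z => f (-z)) (by fun_prop) (fun z => by simpa using hM (-z)) (by
    have h := hdecay.comp (Homeomorph.neg ℝ).isClosedEmbedding.tendsto_cocompact
    refine h.congr fun x => ?_
    simp)
  have hfS : Integrable (fun x : ℝ => f x * entireSinc x) := h2.integrable_mul memLp_entireSinc
  have hinv : Integrable (fun x : ℝ => (((1 + x ^ 2)⁻¹ : ℝ) : ℂ)) :=
    integrable_inv_one_add_sq.ofReal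
  have hsum := t1.add t2
  rw [add_zero] at hsum
  have hI : Integrable (fun x : ℝ => 2 * Real.pi * I * (f x * entireSinc x)
      - 2 * I * f 0 * (((1 + x ^ 2)⁻¹ : ℝ) : ℂ)) := (hfS.const_mul _).sub (hinv.const_mul _)
  have hlim := intervalIntegral_tendsto_integral hI tendsto_neg_atTop_atBot tendsto_id
  -- Both f(z)e^{iπz} and f(-z)e^{iπz} are bounded in the upper half-plane. Reflecting the second
  -- integral turns the two exponentials into a sine, and the correction terms into a multiple of
  -- 1/(1 + x²), whose integral π produces `f 0`.
  have heq : ∀ R : ℝ, ((∫ x in (-R)..R, contourKernel (fun z => f z * exp (Real.pi * I * z)) x) +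
      ∫ x in (-R)..R, contourKernel (fun z => f (-z) * exp (Real.pi * I * z)) x) =
      ∫ x in (-R)..id R, (2 * Real.pi * I * (f x * entireSinc x)
      - 2 * I * f 0 * (((1 + x ^ 2)⁻¹ : ℝ) : ℂ)) := by
    intro R
    have hneg : ∫ x in (-R)..R, contourKernel (fun z => f (-z) * exp (Real.pi * I * z)) x =
        ∫ x in (-R)..R, contourKernel (fun z => f (-z) * exp (Real.pi * I * z)) ((-x : ℝ) : ℂ) := by
      rw [intervalIntegral.integral_comp_neg
        (fun x : ℝ => contourKernel (fun z => f (-z) * exp (Real.pi * I * z)) x), neg_neg]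
    have i2' : IntervalIntegrable (fun x : ℝ =>
        contourKernel (fun z => f (-z) * exp (Real.pi * I * z)) ((-x : ℝ) : ℂ)) volume (-R) R := by
      have := (i2 (-R)).comp_sub_left 0
      simpa using this
    rw [hneg, ← intervalIntegral.integral_add (i1 R) i2']
    refine intervalIntegral.integral_congr_ae ?_
    have hne : ∀ᵐ x : ℝ, x ≠ 0 := by
      simp [ae_iff]
    filter_upwards [hne] with x hx _
    have hx' : (x : ℂ) ≠ 0 := by exact_mod_cast hx
    have hp : (x : ℂ) + I ≠ 0 := by
      intro h; have := congrArg im h; simp at this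
    have hm : -(x : ℂ) + I ≠ 0 := by
      intro h; have := congrArg im h; simp at this
    have hq : (1 + x ^ 2 : ℂ) ≠ 0 := by
      have : (1 + x ^ 2 : ℂ) = -((x + I) * (-x + I)) := by linear_combination I_sq
      rw [this]
      exact neg_ne_zero.2 (mul_ne_zero hp hm)
    have hpi : (Real.pi : ℂ) ≠ 0 := by exact_mod_cast Real.pi_ne_zero
    have hid : I / (x + I) + I / (x - I) = 2 * I * x * (1 + x ^ 2 : ℂ)⁻¹ := by
      have hm' : (x : ℂ) - I ≠ 0 := by
        intro h; apply hm; linear_combination -h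
      field_simp
      linear_combination (2 * x : ℂ) * I_sq
    have hm2 : I / (-(x : ℂ) + I) = - (I / (x - I)) := by
      rw [← div_neg]; congr 1; ring
    rw [contourKernel_of_ne hx', contourKernel_of_ne (by push_cast; exact neg_ne_zero.2 hx'),
      entireSinc_of_ne hx']
    push_cast
    simp only [neg_zero, mul_zero, Complex.exp_zero, mul_one, neg_neg, hm2, Complex.sin]
    have e1 : (Real.pi : ℂ) * I * x = Real.pi * x * I := by ring
    have e2 : (Real.pi : ℂ) * I * -x = -(Real.pi * x) * I := by ring
    rw [e1, e2]
    have hid2 : 2 * I * f 0 * (1 + x ^ 2 : ℂ)⁻¹ = f 0 * (I / (x + I) + I / (x - I)) / x := by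
      rw [hid]; field_simp
    rw [hid2]
    generalize I / (x + I) = P
    generalize I / (x - I) = Q
    generalize exp (Real.pi * x * I) = E₁
    generalize exp (-(Real.pi * x) * I) = E₂
    field_simp
    linear_combination (E₁ - E₂) * f x * I_sq
  have hlim2 := tendsto_nhds_unique (hsum.congr heq) hlim
  rw [integral_sub (hfS.const_mul _) (hinv.const_mul _), integral_const_mul, integral_const_mul,
    integral_complex_ofReal, integral_univ_inv_one_add_sq] at hlim2
  have hpi : (2 * Real.pi * I : ℂ) ≠ 0 := two_pi_I_ne_zero
  refine mul_left_cancel₀ hpi ?_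
  linear_combination -hlim2

/-! ### Dividing out the labelled zeros -/

/-- The polynomial with value `1` at the origin and with zeros `z j`, `j ∈ s`. -/
noncomputable def zeroProd (z : ℤ → ℝ) (s : Finset ℤ) (w : ℂ) : ℂ := ∏ j ∈ s, (1 - w / z j)

theorem differentiable_zeroProd (z : ℤ → ℝ) (s : Finset ℤ) : Differentiable ℂ (zeroProd z s) := by
  unfold zeroProd
  fun_prop

theorem zeroProd_zero (z : ℤ → ℝ) (s : Finset ℤ) : zeroProd z s 0 = 1 := by
  simp [zeroProd]

theorem zeroProd_ofReal (z : ℤ → ℝ) (s : Finset ℤ) (x : ℝ) :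
    zeroProd z s x = ((∏ j ∈ s, (1 - x / z j) : ℝ) : ℂ) := by
  simp [zeroProd]

theorem analyticOrderAt_zeroProd {z : ℤ → ℝ} {s : Finset ℤ} (hs : ∀ j ∈ s, z j ≠ 0) (x : ℝ) :
    analyticOrderAt (zeroProd z s) (x : ℂ) = (s.filter (fun j => z j = x)).card := by
  induction s using Finset.induction_on with
  | empty =>
    rw [(analyticOrderAt_eq_zero).2 (Or.inr (by simp [zeroProd]))]
    simp
  | insert k s hk ih =>
    have hzk : (z k : ℂ) ≠ 0 := by exact_mod_cast hs k (Finset.mem_insert_self k s)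
    have heq : zeroProd z (insert k s) =
        ((fun _ : ℂ => -(z k : ℂ)⁻¹) * fun w : ℂ => w - z k) * zeroProd z s := by
      ext w
      simp only [zeroProd, Pi.mul_apply, Finset.prod_insert hk]
      congr 1
      field_simp
      ring
    have ha : AnalyticAt ℂ (fun _ : ℂ => -(z k : ℂ)⁻¹) x := analyticAt_const
    have hb : AnalyticAt ℂ (fun w : ℂ => w - z k) x := by fun_prop
    rw [heq, analyticOrderAt_mul (ha.mul hb) ((differentiable_zeroProd z s).analyticAt _),
      analyticOrderAt_mul ha hb, ih fun j hj => hs j (Finset.mem_insert_of_mem hj),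
      (analyticOrderAt_eq_zero (f := fun _ : ℂ => -(z k : ℂ)⁻¹)).2 (Or.inr (by simpa using hzk)),
      zero_add, Finset.filter_insert]
    split_ifs with h
    · rw [← h, analyticOrderAt_id_sub_const_self, Finset.card_insert_of_notMem (by simp [hk])]
      push_cast
      rw [add_comm]
    · rw [analyticOrderAt_id_sub_const_of_ne (by exact_mod_cast Ne.symm h), zero_add]

namespace IsZeroLabelling

variable {f : ℂ → ℂ} {J : Set ℤ} {z : ℤ → ℝ}

theorem ne_zero (h : IsZeroLabelling f J z) {j : ℤ} (hj : j ∈ J) (hj0 : j ≠ 0) : z j ≠ 0 := by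
  rcases lt_or_gt_of_ne hj0 with h1 | h1
  · exact (h.neg j hj h1).ne
  · exact (h.pos j hj h1).ne'

/-- Finitely many of the labelled zeros can be divided out. -/
theorem exists_eq_mul_zeroProd (h : IsZeroLabelling f J z) (hf : Differentiable ℂ f)
    (s : Finset ℤ) (hs : ∀ j ∈ s, j ∈ J ∧ j ≠ 0) :
    ∃ q : ℂ → ℂ, Differentiable ℂ q ∧ f = q * zeroProd z s := by
  induction s using Finset.induction_on with
  | empty => exact ⟨f, hf, by ext w; simp [zeroProd]⟩
  | insert k s hk ih =>
    have hs' : ∀ j ∈ s, j ∈ J ∧ j ≠ 0 := fun j hj => hs j (Finset.mem_insert_of_mem hj)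
    obtain ⟨q, hq, hfq⟩ := ih hs'
    have hkJ := hs k (Finset.mem_insert_self k s)
    have hzk : (z k : ℂ) ≠ 0 := by exact_mod_cast h.ne_zero hkJ.1 hkJ.2
    -- Otherwise the order of `f` at `z k` would be the number of labels in `s` with that value,
    -- while `k` supplies one more.
    have hq0 : q (z k) = 0 := by
      by_contra hne
      have h1 := h.order_eq (z k)
      rw [hfq, analyticOrderAt_mul (hq.analyticAt _) ((differentiable_zeroProd z s).analyticAt _),
        analyticOrderAt_zeroProd fun j hj => h.ne_zero (hs' j hj).1 (hs' j hj).2,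
        analyticOrderAt_eq_zero.2 (Or.inr hne), zero_add] at h1
      have h2 : (((insert k s).filter (fun j => z j = z k) : Finset ℤ) : Set ℤ) ⊆
          {j : ℤ | j ∈ J ∧ j ≠ 0 ∧ z j = z k} := by
        intro j hj
        rw [Finset.mem_coe, Finset.mem_filter] at hj
        exact ⟨(hs j hj.1).1, (hs j hj.1).2, hj.2⟩
      have h3 := Set.encard_le_encard h2
      rw [← h1, Set.encard_coe_eq_coe_finsetCard, Finset.filter_insert, if_pos rfl,
        Finset.card_insert_of_notMem (by simp [hk])] at h3
      have h4 : (s.filter (fun j => z j = z k)).card + 1 ≤ (s.filter (fun j => z j = z k)).card := by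
        exact_mod_cast h3
      omega
    refine ⟨fun w => -(z k : ℂ) * dslope q (z k) w, ?_, ?_⟩
    · refine (Differentiable.const_mul ?_ _)
      rw [← differentiableOn_univ, differentiableOn_dslope univ_mem]
      exact hq.differentiableOn
    · ext w
      have h1 := sub_smul_dslope q (z k : ℂ) w
      rw [hq0, sub_zero, smul_eq_mul] at h1
      have h2 : -(z k : ℂ) * (1 - w / z k) = w - z k := by field_simp; ring
      rw [hfq]
      simp only [Pi.mul_apply, zeroProd, Finset.prod_insert hk]
      linear_combination (-∏ j ∈ s, (1 - w / z j)) * h1 -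
        dslope q (z k) w * (∏ j ∈ s, (1 - w / z j)) * h2

/-- Once all labelled copies of a real zero have been divided out, the quotient does not vanish
there. -/
theorem quotient_ne_zero (h : IsZeroLabelling f J z)
    {s : Finset ℤ} (hs : ∀ j ∈ s, j ∈ J ∧ j ≠ 0) {q : ℂ → ℂ} (hq : Differentiable ℂ q)
    (hfq : f = q * zeroProd z s) {x : ℝ} (hx : ∀ j ∈ J, j ≠ 0 → z j = x → j ∈ s) :
    q x ≠ 0 := by
  have h1 := h.order_eq x
  have h2 : {j : ℤ | j ∈ J ∧ j ≠ 0 ∧ z j = x} = (s.filter (fun j => z j = x) : Finset ℤ) := by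
    ext j
    simp only [mem_ofPred_eq, Finset.coe_filter]
    exact ⟨fun hj => ⟨hx j hj.1 hj.2.1 hj.2.2, hj.2.2⟩,
      fun hj => ⟨(hs j hj.1).1, (hs j hj.1).2, hj.2⟩⟩
  rw [hfq, analyticOrderAt_mul (hq.analyticAt _) ((differentiable_zeroProd z s).analyticAt _),
    analyticOrderAt_zeroProd fun j hj => h.ne_zero (hs j hj).1 (hs j hj).2, h2,
    Set.encard_coe_eq_coe_finsetCard] at h1
  have h3 : analyticOrderAt q (x : ℂ) = 0 := by
    generalize analyticOrderAt q (x : ℂ) = n at h1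
    cases n with
    | top => simp at h1
    | coe n =>
      have : n + (s.filter (fun j => z j = x)).card = (s.filter (fun j => z j = x)).card := by
        exact_mod_cast h1
      have : n = 0 := by omega
      simp [this]
  rcases analyticOrderAt_eq_zero.1 h3 with h4 | h4
  · exact absurd (hq.analyticAt _) h4
  · exact h4

end IsZeroLabelling

/-! ### The bound on the imaginary axis -/

theorem im_deriv_eq_zero_of_real {g : ℂ → ℂ} (hg : DifferentiableAt ℂ g 0)
    (hr : ∀ᶠ x : ℝ in 𝓝 0, (g x).im = 0) : (deriv g 0).im = 0 := by
  have h1 : HasDerivAt g (deriv g 0) ((0 : ℝ) : ℂ) := by simpa using hg.hasDerivAt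
  have h2 : HasDerivAt (fun x : ℝ => (g x).im) (deriv g 0).im 0 :=
    imCLM.hasFDerivAt.comp_hasDerivAt (0 : ℝ) h1.comp_ofReal
  have h3 : HasDerivAt (fun x : ℝ => (g x).im) 0 0 :=
    (hasDerivAt_const (0 : ℝ) (0 : ℝ)).congr_of_eventuallyEq hr
  exact h2.unique h3

/-- Partial products of the Euler product for `sinh (π u) / (π u)`. -/
theorem euler_prod_le (y : ℝ) (N : ℕ) :
    ∏ k ∈ Finset.range N, (1 + y ^ 2 / ((k : ℝ) + 1) ^ 2) ≤ Real.exp (Real.pi * (|y| + 1)) := by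
  -- Passing from `|y|` to `u ≥ 1` makes the prefactor `π * u` of Euler's product at least 1, so it
  -- can be dropped.
  set u : ℝ := |y| + 1 with hu
  have hu1 : 1 ≤ u := by simp [hu]
  have hpi := Real.pi_gt_three
  have hmono : Monotone (fun n : ℕ =>
      Real.pi * u * ∏ k ∈ Finset.range n, (1 + u ^ 2 / ((k : ℝ) + 1) ^ 2)) := by
    refine monotone_nat_of_le_succ fun n => ?_
    rw [Finset.prod_range_succ]
    refine mul_le_mul_of_nonneg_left (le_mul_of_one_le_right ?_ ?_) (by positivity)
    · exact Finset.prod_nonneg fun k _ => by positivity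
    · linarith [show 0 ≤ u ^ 2 / ((n : ℝ) + 1) ^ 2 by positivity]
  have hlim : Tendsto (fun n : ℕ =>
      Real.pi * u * ∏ k ∈ Finset.range n, (1 + u ^ 2 / ((k : ℝ) + 1) ^ 2)) atTop
      (𝓝 ‖Complex.sin (Real.pi * (u * I))‖) := by
    refine (Complex.tendsto_euler_sin_prod (u * I)).norm.congr fun n => ?_
    have : ∏ j ∈ Finset.range n, ((1 : ℂ) - (u * I) ^ 2 / ((j : ℂ) + 1) ^ 2) =
        ((∏ k ∈ Finset.range n, (1 + u ^ 2 / ((k : ℝ) + 1) ^ 2) : ℝ) : ℂ) := by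
      push_cast
      refine Finset.prod_congr rfl fun j _ => ?_
      rw [mul_pow, I_sq]
      ring
    rw [this, norm_mul, norm_mul, norm_mul, norm_I, norm_real, norm_real, norm_real,
      Real.norm_of_nonneg Real.pi_pos.le, Real.norm_of_nonneg (by linarith : 0 ≤ u),
      Real.norm_of_nonneg (Finset.prod_nonneg fun k _ => by positivity), mul_one]
  have h1 := hmono.ge_of_tendsto hlim N
  have h2 : ‖Complex.sin (Real.pi * (u * I))‖ ≤ Real.exp (Real.pi * u) := by
    have := norm_sin_le (Real.pi * (u * I))
    simpa [abs_of_pos Real.pi_pos, abs_of_nonneg (by linarith : 0 ≤ u)] using this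
  have h3 : ∏ k ∈ Finset.range N, (1 + y ^ 2 / ((k : ℝ) + 1) ^ 2) ≤
      ∏ k ∈ Finset.range N, (1 + u ^ 2 / ((k : ℝ) + 1) ^ 2) := by
    refine Finset.prod_le_prod (fun k _ => by positivity) fun k _ => ?_
    have : y ^ 2 ≤ u ^ 2 := by
      rw [← sq_abs y]
      gcongr
      linarith
    gcongr
  have h4 : ∏ k ∈ Finset.range N, (1 + u ^ 2 / ((k : ℝ) + 1) ^ 2) ≤
      Real.pi * u * ∏ k ∈ Finset.range N, (1 + u ^ 2 / ((k : ℝ) + 1) ^ 2) := by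
    refine le_mul_of_one_le_left (Finset.prod_nonneg fun k _ => by positivity) ?_
    nlinarith
  linarith

/-- For `n = 0` the hypothesis gives no lower bound, so that factor is kept apart; the others are
compared with Euler's product. -/
theorem prod_one_add_sq_div_le {c : ℕ → ℝ} {t : Finset ℕ} (hc : ∀ n ∈ t, (n : ℝ) ≤ |c n|) (y : ℝ) :
    ∏ n ∈ t, (1 + y ^ 2 / c n ^ 2) ≤ (1 + y ^ 2 / c 0 ^ 2) * Real.exp (Real.pi * (|y| + 1)) := by
  set b : ℕ → ℝ := fun n => 1 + y ^ 2 / (if n = 0 then c 0 else (n : ℝ)) ^ 2 with hb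
  have hb1 : ∀ n, 1 ≤ b n := fun n => by
    simp only [hb]
    linarith [show 0 ≤ y ^ 2 / (if n = 0 then c 0 else (n : ℝ)) ^ 2 by positivity]
  obtain ⟨N, hN⟩ := t.exists_nat_subset_range
  calc ∏ n ∈ t, (1 + y ^ 2 / c n ^ 2) ≤ ∏ n ∈ t, b n := by
        refine Finset.prod_le_prod (fun n _ => by positivity) fun n hn => ?_
        simp only [hb]
        rcases eq_or_ne n 0 with rfl | hn0
        · simp
        · have : 0 < (n : ℝ) := by positivity
          rw [if_neg hn0, ← sq_abs (c n)]
          have := hc n hn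
          gcongr
    _ ≤ ∏ n ∈ Finset.range (N + 1), b n := by
        refine Finset.prod_le_prod_of_subset_of_one_le
          (hN.trans (Finset.range_mono (Nat.le_succ N))) ?_ ?_
        · exact fun n _ => zero_le_one.trans (hb1 n)
        · exact fun n _ _ => hb1 n
    _ = (∏ k ∈ Finset.range N, (1 + y ^ 2 / ((k : ℝ) + 1) ^ 2)) * (1 + y ^ 2 / c 0 ^ 2) := by
        rw [Finset.prod_range_succ']
        simp [hb]
    _ ≤ _ := by
        rw [mul_comm]
        gcongr
        exact euler_prod_le y N

/-- On each side the label `j = σ * (n + 1)` gets index `n = |j| - 1`, exactly the lower bound for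
`|z j|`. The factors at `±1` are at least 1, so they do no harm if those labels are not in `s`. -/
theorem prod_labels_le {z : ℤ → ℝ} {s : Finset ℤ} (hs : ∀ j ∈ s, j ≠ 0)
    (hz : ∀ j ∈ s, |(j : ℝ)| - 1 ≤ |z j|) (y : ℝ) :
    ∏ j ∈ s, (1 + y ^ 2 / z j ^ 2) ≤ (1 + y ^ 2 / z 1 ^ 2) * (1 + y ^ 2 / z (-1) ^ 2) *
      Real.exp (2 * Real.pi * (|y| + 1)) := by
  have hside : ∀ σ : ℤ, σ = 1 ∨ σ = -1 → ∀ t : Finset ℤ, t ⊆ s → (∀ j ∈ t, 0 < σ * j) →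
      ∏ j ∈ t, (1 + y ^ 2 / z j ^ 2) ≤
        (1 + y ^ 2 / z σ ^ 2) * Real.exp (Real.pi * (|y| + 1)) := by
    intro σ hσ t hts ht
    have hinv : ∀ j ∈ t, σ * (((σ * j - 1).toNat : ℤ) + 1) = j := by
      intro j hj
      have := ht j hj
      rcases hσ with rfl | rfl <;> omega
    have hinj : Set.InjOn (fun j : ℤ => (σ * j - 1).toNat) (t : Set ℤ) := by
      intro j hj k hk hjk
      rw [← hinv j hj, ← hinv k hk]
      simp only at hjk
      rw [hjk]
    have h1 : ∏ n ∈ t.image (fun j : ℤ => (σ * j - 1).toNat),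
        (1 + y ^ 2 / z (σ * ((n : ℤ) + 1)) ^ 2) = ∏ j ∈ t, (1 + y ^ 2 / z j ^ 2) := by
      rw [Finset.prod_image hinj]
      exact Finset.prod_congr rfl fun j hj => by rw [hinv j hj]
    rw [← h1]
    have h2 := prod_one_add_sq_div_le (c := fun n : ℕ => z (σ * ((n : ℤ) + 1)))
      (t := t.image (fun j : ℤ => (σ * j - 1).toNat)) (fun n hn => by
        obtain ⟨j, hj, rfl⟩ := Finset.mem_image.1 hn
        rw [hinv j hj]
        refine le_trans (le_of_eq ?_) (hz j (hts hj))
        have h3 : |j| = ((σ * j - 1).toNat : ℤ) + 1 := by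
          have := ht j hj
          rcases hσ with rfl | rfl
          · rw [abs_of_pos (by omega)]; omega
          · rw [abs_of_neg (by omega)]; omega
        have h4 : ((|j| : ℤ) : ℝ) = ((σ * j - 1).toNat : ℝ) + 1 := by
          rw [h3]; push_cast; rfl
        rw [← Int.cast_abs, h4]
        ring) y
    simpa using h2
  have hp := hside 1 (Or.inl rfl) (s.filter (0 < ·)) (Finset.filter_subset _ _)
    (fun j hj => by simpa using (Finset.mem_filter.1 hj).2)
  have hn := hside (-1) (Or.inr rfl) (s.filter (¬ 0 < ·)) (Finset.filter_subset _ _)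
    (fun j hj => by
      have h1 := Finset.mem_filter.1 hj
      have h2 := hs j h1.1
      omega)
  rw [← Finset.prod_filter_mul_prod_filter_not s (0 < ·)]
  calc _ ≤ ((1 + y ^ 2 / z 1 ^ 2) * Real.exp (Real.pi * (|y| + 1))) *
        ((1 + y ^ 2 / z (-1) ^ 2) * Real.exp (Real.pi * (|y| + 1))) :=
        mul_le_mul hp hn (Finset.prod_nonneg fun j _ => by positivity) (by positivity)
    _ = _ := by
      rw [show 2 * Real.pi * (|y| + 1) = Real.pi * (|y| + 1) + Real.pi * (|y| + 1) by ring,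
        Real.exp_add]
      ring

theorem norm_zeroProd_imaginary_sq (z : ℤ → ℝ) (s : Finset ℤ) (y : ℝ) :
    ‖zeroProd z s (y * I)‖ ^ 2 = ∏ j ∈ s, (1 + y ^ 2 / z j ^ 2) := by
  rw [zeroProd, norm_prod, ← Finset.prod_pow]
  refine Finset.prod_congr rfl fun j _ => ?_
  have : (1 : ℂ) - y * I / z j = ((1 : ℝ) : ℂ) + ((-(y / z j) : ℝ) : ℂ) * I := by
    push_cast; ring
  rw [this, Complex.sq_norm, normSq_add_mul_I]
  ring

/-- The quotient by the zeros in a disc of radius `R` contributes a factor that tends to 1 as first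
`R → ∞`, then `ε → 0`. Only the finite products remain, and their bound does not depend on `R`. -/
theorem exists_norm_le_imaginary_axis {f : ℂ → ℂ} {J : Set ℤ} {z : ℤ → ℝ}
    (hf : Differentiable ℂ f) (h_one : f 0 = 1) (h_real : ∀ x : ℝ, (f (x : ℂ)).im = 0)
    (h_zeros : ∀ w : ℂ, f w = 0 → w.im = 0) (h : IsZeroLabelling f J z)
    (hz : ∀ j ∈ J, |(j : ℝ)| - 1 ≤ |z j|) (h_growth : MinimalOrderTwo f) (y : ℝ) :
    ‖f (y * I)‖ ≤ √((1 + y ^ 2 / z 1 ^ 2) * (1 + y ^ 2 / z (-1) ^ 2) *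
      Real.exp (2 * Real.pi * (|y| + 1))) := by
  classical
  set W : ℝ := √((1 + y ^ 2 / z 1 ^ 2) * (1 + y ^ 2 / z (-1) ^ 2) *
      Real.exp (2 * Real.pi * (|y| + 1))) with hW
  have hR : ∀ ε : ℝ, 0 < ε → ∀ C : ℝ, 1 ≤ C →
      (∀ w : ℂ, ‖f w‖ ≤ C * Real.exp (ε * ‖w‖ ^ 2)) → ∀ R : ℝ, 0 < R → |y| < R / 2 →
      ‖f (y * I)‖ ≤ Real.exp (16 * (Real.log C + 9 * ε * R ^ 2) * y ^ 2 / R ^ 2) * W := by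
    intro ε hε C hC hgr R hR0 hyR
    obtain ⟨s, hs⟩ : ∃ s : Finset ℤ, ∀ j, j ∈ s ↔ j ∈ J ∧ j ≠ 0 ∧ |z j| < R := by
      refine ⟨(Finset.Icc (-⌈R + 1⌉) ⌈R + 1⌉).filter
        (fun j => j ∈ J ∧ j ≠ 0 ∧ |z j| < R), fun j => ?_⟩
      rw [Finset.mem_filter, and_iff_right_iff_imp]
      rintro ⟨h1, -, h2⟩
      have h3 : (|j| : ℝ) ≤ (⌈R + 1⌉ : ℤ) := by linarith [hz j h1, Int.le_ceil (R + 1)]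
      rw [Finset.mem_Icc, ← abs_le]
      exact_mod_cast h3
    have hsJ : ∀ j ∈ s, j ∈ J ∧ j ≠ 0 := fun j hj => ⟨((hs j).1 hj).1, ((hs j).1 hj).2.1⟩
    obtain ⟨q, hq, hfq⟩ := h.exists_eq_mul_zeroProd hf s hsJ
    have hq0 : q 0 = 1 := by
      have := congrFun hfq 0
      simpa [zeroProd_zero, h_one] using this.symm
    have hne : ∀ w ∈ ball (0 : ℂ) R, q w ≠ 0 := by
      intro w hw hqw
      have hfw : f w = 0 := by rw [hfq, Pi.mul_apply, hqw, zero_mul]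
      have him := h_zeros w hfw
      have hwr : w = ((w.re : ℝ) : ℂ) := Complex.ext (by simp) (by simpa using him)
      rw [hwr] at hqw
      refine h.quotient_ne_zero hsJ hq hfq (fun j h1 h2 h3 => (hs j).2 ⟨h1, h2, ?_⟩) hqw
      rw [h3]
      exact (abs_re_le_norm w).trans_lt (by simpa using hw)
    have hM : 0 < Real.log C + 9 * ε * R ^ 2 := by
      have := Real.log_nonneg hC
      positivity
    -- On the circle of radius `3 * R` every factor has modulus at least 2, so the bound for `f`
    -- passes to `q` there and, by the maximum principle, to the disc. This is the source of `9 * ε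
    -- * R ^ 2`.
    have hP : ∀ w : ℂ, ‖w‖ = 3 * R → 1 ≤ ‖zeroProd z s w‖ := by
      intro w hw
      rw [zeroProd, norm_prod]
      refine Finset.one_le_prod fun j hj => ?_
      have h1 := (hs j).1 hj
      have h2 : 0 < |z j| := abs_pos.2 (h.ne_zero h1.1 h1.2.1)
      have h3 : 3 ≤ ‖w / z j‖ := by
        rw [norm_div, norm_real, Real.norm_eq_abs, le_div_iff₀ h2, hw]
        linarith [h1.2.2]
      have h4 := norm_sub_norm_le (w / z j) 1
      rw [norm_sub_rev, norm_one] at h4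
      linarith
    have hb : ∀ w ∈ ball (0 : ℂ) R, ‖q w‖ ≤ Real.exp (Real.log C + 9 * ε * R ^ 2) := by
      intro w hw
      refine norm_le_of_forall_mem_frontier_norm_le (isBounded_ball (x := (0 : ℂ)) (r := 3 * R))
        hq.diffContOnCl (fun w hw => ?_) (subset_closure (ball_subset_ball (by linarith) hw))
      have hw' : ‖w‖ = 3 * R := by
        have := frontier_ball_subset_sphere hw
        simpa using this
      have h1 : ‖f w‖ = ‖q w‖ * ‖zeroProd z s w‖ := by rw [hfq, Pi.mul_apply, norm_mul]
      have h2 : ‖q w‖ ≤ ‖f w‖ := by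
        rw [h1]; exact le_mul_of_one_le_right (norm_nonneg _) (hP w hw')
      refine h2.trans ((hgr w).trans (le_of_eq ?_))
      rw [hw', Real.exp_add, Real.exp_log (by linarith)]
      ring_nf
    have hder : (deriv q 0).im = 0 := by
      refine im_deriv_eq_zero_of_real (hq 0) ?_
      have hc : ContinuousAt (fun x : ℝ => zeroProd z s x) 0 :=
        ((differentiable_zeroProd z s).continuous.comp continuous_ofReal).continuousAt
      have hne0 : zeroProd z s ((0 : ℝ) : ℂ) ≠ 0 := by simp [zeroProd_zero]
      filter_upwards [hc.eventually_ne hne0] with x hx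
      have h1 : q x = f x / zeroProd z s x := by
        rw [eq_div_iff hx, hfq, Pi.mul_apply]
      rw [h1, zeroProd_ofReal, div_ofReal_im, h_real, zero_div]
    have hfin := norm_le_exp_on_imaginary_axis hR0 hM hq.differentiableOn hq0 hne hb hder hyR
    have hPW : ‖zeroProd z s (y * I)‖ ≤ W := by
      refine Real.le_sqrt_of_sq_le ?_
      rw [norm_zeroProd_imaginary_sq]
      exact prod_labels_le (fun j hj => (hsJ j hj).2) (fun j hj => hz j (hsJ j hj).1) y
    have h1 : f (y * I) = q (y * I) * zeroProd z s (y * I) := by rw [hfq, Pi.mul_apply]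
    rw [h1, norm_mul]
    gcongr
  have hε : ∀ ε : ℝ, 0 < ε → ‖f (y * I)‖ ≤ Real.exp (144 * ε * y ^ 2) * W := by
    intro ε hε
    obtain ⟨C, hC⟩ := h_growth ε hε
    have hC1 : 1 ≤ C := by simpa [h_one] using hC 0
    have hlim : Tendsto (fun R : ℝ =>
        Real.exp (16 * (Real.log C + 9 * ε * R ^ 2) * y ^ 2 / R ^ 2) * W) atTop
        (𝓝 (Real.exp (144 * ε * y ^ 2) * W)) := by
      have h1 : Tendsto (fun R : ℝ => 16 * Real.log C * y ^ 2 * (R ^ 2)⁻¹ + 144 * ε * y ^ 2) atTop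
          (𝓝 (16 * Real.log C * y ^ 2 * 0 + 144 * ε * y ^ 2)) :=
        ((tendsto_pow_atTop two_ne_zero).inv_tendsto_atTop.const_mul _).add_const _
      rw [mul_zero, zero_add] at h1
      refine ((Real.continuous_exp.tendsto _).comp h1).mul_const W |>.congr' ?_
      filter_upwards [eventually_gt_atTop 0] with R hR0
      simp only [Function.comp_apply]
      congr 2
      field_simp
      ring
    refine ge_of_tendsto hlim ?_
    filter_upwards [eventually_gt_atTop 0, eventually_gt_atTop (2 * |y|)] with R h1 h2
    exact hR ε hε C hC1 hC R h1 (by linarith)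
  have hlim : Tendsto (fun ε : ℝ => Real.exp (144 * ε * y ^ 2) * W) (𝓝[>] 0) (𝓝 W) := by
    have hc : Continuous (fun ε : ℝ => Real.exp (144 * ε * y ^ 2) * W) := by fun_prop
    exact (hc.tendsto' 0 _ (by simp)).mono_left nhdsWithin_le_nhds
  exact ge_of_tendsto hlim (eventually_nhdsWithin_of_forall fun ε h => hε ε h)

/-- Absorbs the two leftover quadratic factors into an arbitrarily small exponential, so that they
do not affect the type. -/
theorem one_add_sq_div_le_exp (a : ℝ) {δ : ℝ} (hδ : 0 < δ) {y : ℝ} (hy : 0 ≤ y) :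
    1 + y ^ 2 / a ^ 2 ≤ (1 + 2 / (δ ^ 2 * a ^ 2)) * Real.exp (δ * y) := by
  have h1 := Real.pow_div_factorial_le_exp (δ * y) (by positivity) 2
  have h2 : 1 ≤ Real.exp (δ * y) := Real.one_le_exp (by positivity)
  have h3 : y ^ 2 / a ^ 2 = 2 / (δ ^ 2 * a ^ 2) * ((δ * y) ^ 2 / (Nat.factorial 2 : ℕ)) := by
    rcases eq_or_ne a 0 with rfl | ha
    · simp
    · simp [Nat.factorial]
      field_simp
  rw [h3, add_mul, one_mul]
  gcongr

theorem exists_exp_bound_imaginary_axis {f : ℂ → ℂ} {a b : ℝ}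
    (hf : ∀ y : ℝ, ‖f (y * I)‖ ≤ √((1 + y ^ 2 / a ^ 2) * (1 + y ^ 2 / b ^ 2) *
      Real.exp (2 * Real.pi * (|y| + 1)))) {δ : ℝ} (hδ : 0 < δ) :
    ∃ C : ℝ, ∀ y : ℝ, ‖f (y * I)‖ ≤ C * Real.exp ((Real.pi + δ) * |y|) := by
  set D : ℝ := (1 + 2 / (δ ^ 2 * a ^ 2)) * (1 + 2 / (δ ^ 2 * b ^ 2)) * Real.exp (2 * Real.pi)
  have hD : 0 ≤ D := by positivity
  refine ⟨√D, fun y => (hf y).trans (Real.sqrt_le_iff.2 ⟨by positivity, ?_⟩)⟩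
  have h1 := one_add_sq_div_le_exp a hδ (abs_nonneg y)
  have h2 := one_add_sq_div_le_exp b hδ (abs_nonneg y)
  rw [sq_abs] at h1 h2
  rw [mul_pow, Real.sq_sqrt hD]
  calc _ ≤ ((1 + 2 / (δ ^ 2 * a ^ 2)) * Real.exp (δ * |y|)) *
        ((1 + 2 / (δ ^ 2 * b ^ 2)) * Real.exp (δ * |y|)) *
        Real.exp (2 * Real.pi * (|y| + 1)) := by gcongr
    _ = D * Real.exp ((Real.pi + δ) * |y|) ^ 2 := by
      rw [show 2 * Real.pi * (|y| + 1) = 2 * Real.pi + Real.pi * |y| + Real.pi * |y| by ring,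
        show (Real.pi + δ) * |y| = Real.pi * |y| + δ * |y| by ring,
        Real.exp_add, Real.exp_add, Real.exp_add]
      ring

/-! ### Exponential type π and extremality -/

/-- A minimal order two function, bounded on the real axis and of exponential type `π` along the
positive imaginary axis, is of exponential type `π` in the upper half-plane. -/
theorem MinimalOrderTwo.norm_le_exp_upper_half_plane {f : ℂ → ℂ} (hm : MinimalOrderTwo f)
    (hf : Differentiable ℂ f) {M : ℝ} (hM : ∀ x : ℝ, ‖f x‖ ≤ M)
    (him : ∀ δ : ℝ, 0 < δ → ∃ C : ℝ, ∀ y : ℝ, 0 ≤ y →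
      ‖f (y * I)‖ ≤ C * Real.exp ((Real.pi + δ) * y)) {z : ℂ} (hz : 0 ≤ z.im) :
    ‖f z‖ ≤ M * Real.exp (Real.pi * z.im) := by
  have hn : ∀ w : ℂ, ‖exp (Real.pi * I * w)‖ = Real.exp (-(Real.pi * w.im)) := by
    intro w; rw [Complex.norm_exp]; simp
  -- The factor e^{iπz} has modulus 1 on the line and e^{-πy} at height y, leaving only growth
  -- e^{δy} on the imaginary axis.
  have h := (hm.mul_cexp (Real.pi * I)).norm_le_upper_half_plane (M := M) (by fun_prop)
    (fun x => by simpa [hn] using hM x) (fun δ hδ => by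
      obtain ⟨C, hC⟩ := him δ hδ
      refine ⟨C, fun y hy => ?_⟩
      rw [norm_mul, hn]
      calc _ ≤ C * Real.exp ((Real.pi + δ) * y) * Real.exp (-(Real.pi * (y * I : ℂ).im)) := by
            gcongr; exact hC y hy
        _ = C * Real.exp (δ * y) := by
            rw [mul_assoc, ← Real.exp_add]
            simp
            ring_nf
            simp) hz
  rw [norm_mul, hn, Real.exp_neg, ← div_eq_mul_inv, div_le_iff₀ (Real.exp_pos _)] at h
  exact h

/-- Among the functions of exponential type `π` with `f 0 = 1`, real on the real axis, only
`sin (π z) / (π z)` has `L²` norm at most one. -/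
theorem eq_entireSinc_of_lintegral_le_one {f : ℂ → ℂ} (hf : Differentiable ℂ f) (h_one : f 0 = 1)
    {M : ℝ} (hM : ∀ z, ‖f z‖ ≤ M * Real.exp (Real.pi * |z.im|))
    (h_int : ∫⁻ x : ℝ, ‖f (x : ℂ)‖ₑ ^ 2 ≤ 1) : f = entireSinc := by
  have hc : Continuous (fun x : ℝ => f x) := hf.continuous.comp continuous_ofReal
  have hcS : Continuous (fun x : ℝ => entireSinc x) :=
    differentiable_entireSinc.continuous.comp continuous_ofReal
  have hen : ∀ x : ℝ, ‖f (x : ℂ)‖ₑ ^ 2 = ENNReal.ofReal (‖f x‖ ^ 2) := by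
    intro x
    rw [ENNReal.ofReal_pow (norm_nonneg _), ofReal_norm]
  simp only [hen] at h_int
  have hfi : Integrable (fun x : ℝ => ‖f x‖ ^ 2) := by
    refine ⟨(hc.norm.pow 2).aestronglyMeasurable, ?_⟩
    rw [hasFiniteIntegral_iff_ofReal (Eventually.of_forall fun x => by positivity)]
    exact h_int.trans_lt ENNReal.one_lt_top
  have hf1 : ∫ x : ℝ, ‖f x‖ ^ 2 ≤ 1 := by
    rw [integral_eq_lintegral_of_nonneg_ae (Eventually.of_forall fun x => sq_nonneg _)
      hfi.aestronglyMeasurable]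
    exact ENNReal.toReal_le_of_le_ofReal zero_le_one (by simpa using h_int)
  have hf2 : MemLp (fun x : ℝ => f x) 2 :=
    (memLp_two_iff_integrable_sq_norm hc.aestronglyMeasurable).2 hfi
  obtain ⟨N, hN⟩ := exists_norm_entireSinc_le
  have hreal : ∀ x : ℝ, (entireSinc x).im = 0 := by
    intro x
    rcases eq_or_ne x 0 with rfl | hx
    · simp [entireSinc_zero]
    · rw [entireSinc_of_ne (by exact_mod_cast hx), ← ofReal_mul, ← ofReal_sin, ← ofReal_div,
        ofReal_im]
  have hfS := integral_mul_entireSinc hf hM hf2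
  have hSS := integral_mul_entireSinc differentiable_entireSinc hN memLp_entireSinc
  rw [h_one] at hfS
  rw [entireSinc_zero] at hSS
  have hfSi : Integrable (fun x : ℝ => f x * entireSinc x) := hf2.integrable_mul memLp_entireSinc
  have hSSi : Integrable (fun x : ℝ => entireSinc x * entireSinc x) :=
    memLp_entireSinc.integrable_mul memLp_entireSinc
  have hre1 : ∫ x : ℝ, (f x * entireSinc x).re = 1 := by
    have := integral_re (𝕜 := ℂ) hfSi
    rw [hfS] at this
    simpa using this
  have hre2 : ∫ x : ℝ, (entireSinc x * entireSinc x).re = 1 := by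
    have := integral_re (𝕜 := ℂ) hSSi
    rw [hSS] at this
    simpa using this
  -- Since `entireSinc` is real on the line, the cross term is the real part of the integrand in the
  -- reproducing formula.
  have hexp : ∀ x : ℝ, ‖f x - entireSinc x‖ ^ 2 =
      ‖f x‖ ^ 2 - 2 * (f x * entireSinc x).re + (entireSinc x * entireSinc x).re := by
    intro x
    rw [Complex.sq_norm, Complex.sq_norm, normSq_apply, normSq_apply]
    simp only [sub_re, sub_im, mul_re, hreal]
    ring
  have hfSr : Integrable (fun x : ℝ => (f x * entireSinc x).re) := hfSi.re
  have hSSr : Integrable (fun x : ℝ => (entireSinc x * entireSinc x).re) := hSSi.re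
  have hsub : Integrable (fun x : ℝ => ‖f x‖ ^ 2 - 2 * (f x * entireSinc x).re) :=
    hfi.sub (hfSr.const_mul 2)
  have hdi : Integrable (fun x : ℝ => ‖f x - entireSinc x‖ ^ 2) := by
    simp only [hexp]
    exact hsub.add hSSr
  have hle : ∫ x : ℝ, ‖f x - entireSinc x‖ ^ 2 ≤ 0 := by
    simp only [hexp]
    rw [integral_add hsub hSSr, integral_sub hfi (hfSr.const_mul 2),
      integral_const_mul, hre1, hre2]
    linarith
  have hzero : ∫ x : ℝ, ‖f x - entireSinc x‖ ^ 2 = 0 :=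
    le_antisymm hle (integral_nonneg fun x => by positivity)
  rw [integral_eq_zero_iff_of_nonneg (fun x => by positivity) hdi] at hzero
  have heq := (Continuous.ae_eq_iff_eq volume ((hc.sub hcS).norm.pow 2)
    (g := fun _ => (0 : ℝ)) continuous_const).1 hzero
  have hline : ∀ x : ℝ, f x = entireSinc x := by
    intro x
    have := congrFun heq x
    simpa [sub_eq_zero] using this
  refine AnalyticOnNhd.eq_of_frequently_eq (z₀ := 0) (fun w _ => hf.analyticAt w)
    (fun w _ => differentiable_entireSinc.analyticAt w) ?_
  have ht : Tendsto (fun x : ℝ => (x : ℂ)) (𝓝[≠] 0) (𝓝[≠] 0) := by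
    refine tendsto_nhdsWithin_iff.2 ⟨?_, ?_⟩
    · exact (continuous_ofReal.tendsto' 0 0 (by simp)).mono_left nhdsWithin_le_nhds
    · filter_upwards [self_mem_nhdsWithin] with x hx
      simpa using hx
  exact ht.frequently (Eventually.of_forall hline).frequently

theorem theorem2p1 (f : ℂ → ℂ) (hf : Differentiable ℂ f)
    (h_one : f 0 = 1)
    (h_bdd : ∃ M : ℝ, ∀ x : ℝ, ‖f (x : ℂ)‖ ≤ M)
    (h_int : ∫⁻ x : ℝ, ‖f (x : ℂ)‖ₑ ^ 2 ≤ 1)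
    (h_real : ∀ x : ℝ, (f (x : ℂ)).im = 0)
    (h_zeros : ∀ w : ℂ, f w = 0 → w.im = 0)
    (J : Set ℤ) (z : ℤ → ℝ) (h_label : IsZeroLabelling f J z)
    (h_spacing : ∀ j ∈ J, ∀ k ∈ J, |((j : ℝ) - (k : ℝ))| - 1 ≤ |z j - z k|)
    (h_growth : ∀ ε : ℝ, 0 < ε → ∃ C : ℝ, ∀ w : ℂ, ‖f w‖ ≤ C * Real.exp (ε * ‖w‖ ^ 2)) :
    ∀ w : ℂ, w ≠ 0 → f w = Complex.sin (Real.pi * w) / (Real.pi * w) := by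
  obtain ⟨M, hM⟩ := h_bdd
  have hm : MinimalOrderTwo f := h_growth
  -- Comparison with the label 0, where `z 0 = 0`, is all that Euler's product requires of the
  -- spacing.
  have hz : ∀ j ∈ J, |(j : ℝ)| - 1 ≤ |z j| := by
    intro j hj
    simpa [h_label.map_zero] using h_spacing j hj 0 h_label.zero_mem
  have him : ∀ δ : ℝ, 0 < δ → ∃ C : ℝ, ∀ y : ℝ,
      ‖f (y * I)‖ ≤ C * Real.exp ((Real.pi + δ) * |y|) := fun δ hδ =>
    exists_exp_bound_imaginary_axis
      (exists_norm_le_imaginary_axis hf h_one h_real h_zeros h_label hz hm) hδ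
  have hup : ∀ w : ℂ, 0 ≤ w.im → ‖f w‖ ≤ M * Real.exp (Real.pi * w.im) := fun w hw =>
    hm.norm_le_exp_upper_half_plane hf hM (fun δ hδ => by
      obtain ⟨C, hC⟩ := him δ hδ
      exact ⟨C, fun y hy => by simpa [abs_of_nonneg hy] using hC y⟩) hw
  have hdown : ∀ w : ℂ, 0 ≤ w.im → ‖f (-w)‖ ≤ M * Real.exp (Real.pi * w.im) := by
    intro w hw
    have hneg : MinimalOrderTwo (fun w => f (-1 * w)) := hm.comp_mul (by simp)
    simp only [neg_one_mul] at hneg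
    refine hneg.norm_le_exp_upper_half_plane (by fun_prop) (fun x => by simpa using hM (-x))
      (fun δ hδ => ?_) hw
    obtain ⟨C, hC⟩ := him δ hδ
    exact ⟨C, fun y hy => by simpa [abs_of_nonneg hy] using hC (-y)⟩
  have htype : ∀ w : ℂ, ‖f w‖ ≤ M * Real.exp (Real.pi * |w.im|) := by
    intro w
    rcases le_total 0 w.im with h | h
    · simpa [abs_of_nonneg h] using hup w h
    · simpa [abs_of_nonpos h] using hdown (-w) (by simpa using h)
  intro w hw
  rw [eq_entireSinc_of_lintegral_le_one hf h_one htype h_int, entireSinc_of_ne hw]
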